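/- Let $X_1,\dots,X_n$ be independent random variables with values in a measurable space $\mathcal X$, let $X'_1,\dots,X'_n$ be independent copies of them (so that $X_1,\dots,X_n,X'_1,\dots,X'_n$ are independent and $X'_i$ has the law of $X_i$), let $F:\mathcal X^n\to\mathbb R$ be measurable, and put $$Z=F(X_1,\dots,X_n),\qquad Z'_i=F(X_1,\dots,X_{i-1},X'_i,X_{i+1},\dots,X_n).$$ With $x_+=\max(x,0)$ and $x_-=\max(-x,0)$, define the (a priori $[0,\infty]$-valued) conditional expectations $$V^+=\mathbb E\Big[\sum_{i=1}^n (Z-Z'_i)_+^2\,\Big|\,X_1,\dots,X_n\Big],\qquad V^-=\mathbb E\Big[\sum_{i=1}^n (Z-Z'_i)_-^2\,\Big|\,X_1,\dots,X_n\Big].$$ Let $K=1/(e-\sqrt e)$ and $\|Y\|_q=(\mathbb E|Y|^q)^{1/q}$. **Theorem 1.** Suppose that $V^+\le c$ almost surely for some constant $c\ge 0$. Then $Z$ is integrable and, for all integers $q\ge 2$, $$\|(Z-\mathbb E Z)_+\|_q\le\sqrt{Kqc}.$$ If furthermore $V^-\le c$ almost surely, then for all integers $q\ge 2$, $$\|Z\|_q\le|\mathbb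 E Z|+2^{1/q}\sqrt{Kqc}.$$ -/

import Mathlib

open MeasureTheory ProbabilityTheory
open scoped ENNReal

noncomputable section

namespace EfronStein

/-- The constant `K = 1 / (e - √e)`. -/
def K : ℝ := 1 / (Real.exp 1 - √(Real.exp 1))

/-- The random variable `Z = F(X₁, …, Xₙ)`. -/
def Z {Ω E : Type*} {n : ℕ} (F : (Fin n → E) → ℝ) (X : Fin n → Ω → E) (ω : Ω) : ℝ :=
  F (fun j => X j ω)

/-- The random variable `Z'ᵢ = F(X₁, …, Xᵢ₋₁, X'ᵢ, Xᵢ₊₁, …, Xₙ)`. -/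
def Z' {Ω E : Type*} {n : ℕ} (F : (Fin n → E) → ℝ) (X X' : Fin n → Ω → E)
    (i : Fin n) (ω : Ω) : ℝ :=
  F (Function.update (fun j => X j ω) i (X' i ω))

/-- The sub-σ-algebra of `Ω` generated by the vector `(X₁, …, Xₙ)`. -/
abbrev sigmaX {Ω E : Type*} [MeasurableSpace E] {n : ℕ} (X : Fin n → Ω → E) :
    MeasurableSpace Ω :=
  MeasurableSpace.comap (fun ω j => X j ω) MeasurableSpace.pi

/-- `V⁺ = 𝔼[∑ᵢ (Z - Z'ᵢ)₊² | X₁, …, Xₙ]`, the conditional expectation of a `[0, ∞]`-valued random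
variable (so that no integrability is needed for it to be meaningful). -/
def Vplus {Ω E : Type*} [MeasurableSpace Ω] [MeasurableSpace E] (P : Measure Ω) {n : ℕ}
    (F : (Fin n → E) → ℝ) (X X' : Fin n → Ω → E) : Ω → ℝ≥0∞ :=
  condLExp (sigmaX X) P (fun ω => ∑ i, ENNReal.ofReal ((Z F X ω - Z' F X X' i ω)⁺ ^ 2))

/-- `V⁻ = 𝔼[∑ᵢ (Z - Z'ᵢ)₋² | X₁, …, Xₙ]`, where `x₋ = max (-x) 0`. -/
def Vminus {Ω E : Type*} [MeasurableSpace Ω] [MeasurableSpace E] (P : Measure Ω) {n : ℕ}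
    (F : (Fin n → E) → ℝ) (X X' : Fin n → Ω → E) : Ω → ℝ≥0∞ :=
  condLExp (sigmaX X) P (fun ω => ∑ i, ENNReal.ofReal ((Z F X ω - Z' F X X' i ω)⁻ ^ 2))

end EfronStein

end

namespace EfronStein

/-! This is the entropy method for moments. For bounded `w ≥ 0`, the entropy `E w^(m+1) - (E
w^m)^((m+1)/m)`, attached to the convex function `y ↦ y^((m+1)/m)` of `y = w^m`, is at most the sum
of the expected entropies in each coordinate separately (`integral_pow_sub_pnorm_pow_le_sum`). This
rests on the joint convexity of the associated Bregman divergence (`exists_bregman_support`). In one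
coordinate, symmetrization with an independent copy bounds the entropy by `E m w^(m-1) (w - w')₊²`.

For `w = (F - E F)₊` and `V⁺ ≤ c` this gives `E w^(m+1) ≤ (E w^m)^((m+1)/m) + m c E w^(m-1)`
(`integral_pow_succ_le`). Inserting the guess `E w^k ≤ (K k c)^(k/2)` leaves a numerical inequality
(`sqrt_pow_step`) whose large-`m` limit is `e^(-1/2) + e^(-1)/K = 1`, which is why `K = 1/(e - √e)`.
The exponents `1` and `2` follow from the variance bound `c`.

Truncation removes boundedness, and a uniform variance bound yields integrability of `F`. The
two-sided bound applies the result to `F` and `-F` and adds the `q`-th moments of the two parts. -/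

/-! ### Joint convexity of the Bregman divergence. -/

lemma young_pow (m : ℕ) {s u : ℝ} (hs : 0 ≤ s) (hu : 0 ≤ u) :
    (m + 1) * s * u ^ m ≤ s ^ (m + 1) + m * u ^ (m + 1) := by
  induction m with
  | zero => simp
  | succ k ih =>
    have h1 := mul_le_mul_of_nonneg_left ih hs
    have h2 : 0 ≤ (k + 1) * (u ^ k * (s - u) ^ 2) := by positivity
    push_cast
    ring_nf at h1 h2 ⊢
    linarith

lemma convex_comb_pow_le (m : ℕ) {t x : ℝ} (ht0 : 0 ≤ t) (ht1 : t ≤ 1) (hx : 0 ≤ x) :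
    (t * x + (1 - t)) ^ m ≤ t * x ^ m + (1 - t) := by
  have h := (convexOn_pow m).2 (x := x) (y := 1) hx (by simp) ht0 (sub_nonneg.2 ht1) (by ring)
  simpa using h

/-- The differentiated function is the gap between the divergence and its tangent plane at `(v^m,
1)`, after minimizing over `u`. The minimizer is `u = a + v - 1` when this is nonnegative. -/
lemma hasDerivAt_defect (m : ℕ) (hm : 1 ≤ m) (v a : ℝ) :
    HasDerivAt (fun a : ℝ => a ^ (m + 1) + v ^ (m + 1) - 1
        + ((m + 1) / m) * ((v ^ m - 1) * (a ^ m - 1)) - (a + v - 1) ^ (m + 1))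
      ((m + 1) * (a ^ (m - 1) * (a - 1 + v ^ m) - (a + v - 1) ^ m)) a := by
  have h1 : HasDerivAt (fun a : ℝ => (a + v - 1) ^ (m + 1)) (((m + 1 : ℕ) : ℝ) * (a + v - 1) ^ m * 1) a :=
    HasDerivAt.pow (((hasDerivAt_id' a).add_const v).sub_const 1) (m + 1)
  have h2 := ((((hasDerivAt_pow (m + 1) a).add_const (v ^ (m + 1))).sub_const 1).add
    ((((hasDerivAt_pow m a).sub_const 1).const_mul (v ^ m - 1)).const_mul
      (((m : ℝ) + 1) / m))).sub h1
  refine h2.congr_deriv ?_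
  have hm' : (m : ℝ) ≠ 0 := by positivity
  obtain ⟨k, rfl⟩ : ∃ k, m = k + 1 := ⟨m - 1, by omega⟩
  simp only [Nat.add_sub_cancel]
  push_cast at hm' ⊢
  field_simp
  ring

/-- The gap vanishes at the tangency point `a = 1`. Convexity of `t ↦ t^m` gives its derivative the
sign of `a - 1` on the range used. -/
lemma defect_nonneg_of_one_le (m : ℕ) (hm : 1 ≤ m) {v a : ℝ} (hv : 0 ≤ v) (ha : 0 ≤ a)
    (hs : 0 ≤ a + v - 1) :
    0 ≤ a ^ (m + 1) + v ^ (m + 1) - 1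
        + ((m + 1) / m) * ((v ^ m - 1) * (a ^ m - 1)) - (a + v - 1) ^ (m + 1) := by
  set f : ℝ → ℝ := fun a : ℝ => a ^ (m + 1) + v ^ (m + 1) - 1
        + ((m + 1) / m) * ((v ^ m - 1) * (a ^ m - 1)) - (a + v - 1) ^ (m + 1) with hf
  have hd := hasDerivAt_defect m hm v
  have hcont : Continuous f := continuous_iff_continuousAt.2 fun x => (hd x).continuousAt
  have hf1 : f 1 = 0 := by simp [hf]
  change 0 ≤ f a
  obtain ⟨k, rfl⟩ : ∃ k, m = k + 1 := ⟨m - 1, by omega⟩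
  rcases le_total 1 a with h1 | h1
  · have hmono : MonotoneOn f (Set.Ici 1) := by
      refine monotoneOn_of_deriv_nonneg (convex_Ici 1) hcont.continuousOn
        (fun x _ => (hd x).differentiableAt.differentiableWithinAt) fun x hx => ?_
      rw [interior_Ici] at hx
      have hx0 : 0 < x := lt_trans one_pos hx
      rw [(hd x).deriv]
      -- For `x > 1`, `(x + v - 1) / x` is the average of `v` and `1` with weights `1/x` and `1 -
      -- 1/x`.
      have key := convex_comb_pow_le (k + 1) (t := 1 / x) (by positivity)
        ((div_le_one hx0).2 (le_of_lt hx)) hv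
      have key2 := mul_le_mul_of_nonneg_left key (pow_nonneg hx0.le (k + 1))
      rw [← mul_pow] at key2
      have e1 : x * (1 / x * v + (1 - 1 / x)) = x + v - 1 := by field_simp; ring
      have e2 : x ^ (k + 1) * (1 / x * v ^ (k + 1) + (1 - 1 / x))
          = x ^ k * (x - 1 + v ^ (k + 1)) := by field_simp; ring
      rw [e1, e2] at key2
      simp only [Nat.add_sub_cancel]
      exact mul_nonneg (by positivity) (sub_nonneg.2 key2)
    have := hmono (Set.mem_Ici.2 le_rfl) (Set.mem_Ici.2 h1) h1
    linarith
  · have hanti : AntitoneOn f (Set.Icc a 1) := by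
      refine antitoneOn_of_deriv_nonpos (convex_Icc a 1) hcont.continuousOn
        (fun x _ => (hd x).differentiableAt.differentiableWithinAt) fun x hx => ?_
      rw [interior_Icc] at hx
      have hx0 : 0 < x := lt_of_le_of_lt ha hx.1
      rw [(hd x).deriv]
      have hs' : 0 ≤ x + v - 1 := by linarith [hx.1]
      -- For `x < 1` the roles are exchanged: `v` is the average of `(x + v - 1) / x` and `1` with
      -- weights `x` and `1 - x`.
      have key := convex_comb_pow_le (k + 1) (t := x) hx0.le hx.2.le
        (div_nonneg hs' hx0.le)
      have e1 : x * ((x + v - 1) / x) + (1 - x) = v := by field_simp; ring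
      rw [e1] at key
      have key2 := mul_le_mul_of_nonneg_left key (pow_nonneg hx0.le k)
      have e2 : x ^ k * (x * ((x + v - 1) / x) ^ (k + 1) + (1 - x))
          = (x + v - 1) ^ (k + 1) + x ^ k * (1 - x) := by
        rw [div_pow]; field_simp; ring
      rw [e2] at key2
      simp only [Nat.add_sub_cancel]
      refine mul_nonpos_of_nonneg_of_nonpos (by positivity) ?_
      linarith
    have := hanti (Set.left_mem_Icc.2 h1) (Set.right_mem_Icc.2 h1) h1
    linarith

/-- When `a + v - 1 ≤ 0` the minimum over `u ≥ 0` sits at `u = 0`, so the last power drops out. The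
function decreases in `a` up to `1 - v`, where the previous case applies. -/
lemma defect_nonneg_of_le_one (m : ℕ) (hm : 1 ≤ m) {v a : ℝ} (hv : 0 ≤ v) (ha : 0 ≤ a)
    (hs : a + v - 1 ≤ 0) :
    0 ≤ a ^ (m + 1) + v ^ (m + 1) - 1
        + ((m + 1) / m) * ((v ^ m - 1) * (a ^ m - 1)) := by
  set g : ℝ → ℝ := fun a : ℝ => a ^ (m + 1) + v ^ (m + 1) - 1
        + ((m + 1) / m) * ((v ^ m - 1) * (a ^ m - 1)) with hg
  have hd : ∀ x, HasDerivAt g ((m + 1) * (x ^ (m - 1) * (x - 1 + v ^ m))) x := by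
    intro x
    have h := (hasDerivAt_defect m hm v x).add
      (HasDerivAt.pow (((hasDerivAt_id' x).add_const v).sub_const 1) (m + 1))
    refine (h.congr_deriv ?_).congr_of_eventuallyEq (Filter.Eventually.of_forall fun y => ?_)
    · simp; ring
    · simp [hg]
  have hcont : Continuous g := continuous_iff_continuousAt.2 fun x => (hd x).continuousAt
  have hb : 0 ≤ g (1 - v) := by
    have := defect_nonneg_of_one_le m hm (v := v) (a := 1 - v) hv (by linarith) (by linarith)
    rw [show 1 - v + v - 1 = 0 by ring, zero_pow (by omega), sub_zero] at this
    exact this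
  have hle : a ≤ 1 - v := by linarith
  have hanti : AntitoneOn g (Set.Icc a (1 - v)) := by
    refine antitoneOn_of_deriv_nonpos (convex_Icc _ _) hcont.continuousOn
      (fun x _ => (hd x).differentiableAt.differentiableWithinAt) fun x hx => ?_
    rw [interior_Icc] at hx
    have hx0 : 0 < x := lt_of_le_of_lt ha hx.1
    rw [(hd x).deriv]
    have hv1 : v ^ m ≤ v := pow_le_of_le_one hv (by linarith) (by omega)
    refine mul_nonpos_of_nonneg_of_nonpos (by positivity)
      (mul_nonpos_of_nonneg_of_nonpos (by positivity) ?_)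
    linarith [hx.2]
  have := hanti (Set.left_mem_Icc.2 hle) (Set.right_mem_Icc.2 hle) hle
  linarith

/-- The Bregman divergence of `y ↦ y ^ ((m + 1) / m)`, written in the variables `u = y ^ (1 / m)`
and `a = t ^ (1 / m)`. -/
def bregman (m : ℕ) (u a : ℝ) : ℝ :=
  m * u ^ (m + 1) + a ^ (m + 1) - (m + 1) * a * u ^ m

/-- The slopes are the partial derivatives at `(v^m, 1)` in the variables `y = u^m`, `t = a^m`. Here
`bregman` is `m` times the usual divergence with base point `t`. -/
lemma bregman_support_one (m : ℕ) (hm : 1 ≤ m) {u a v : ℝ} (hu : 0 ≤ u) (ha : 0 ≤ a)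
    (hv : 0 ≤ v) :
    bregman m v 1 + (m + 1) * (v - 1) * (u ^ m - v ^ m)
      + ((m + 1) / m) * (1 - v ^ m) * (a ^ m - 1) ≤ bregman m u a := by
  unfold bregman
  rcases le_total 0 (a + v - 1) with hs | hs
  · have h1 := defect_nonneg_of_one_le m hm hv ha hs
    have h2 := young_pow m hs hu
    rw [pow_succ v] at *
    rw [one_pow]
    linarith
  · have h1 := defect_nonneg_of_le_one m hm hv ha hs
    have h2 : 0 ≤ m * u ^ (m + 1) - (m + 1) * (a + v - 1) * u ^ m := by
      have : (m + 1) * (a + v - 1) * u ^ m ≤ 0 :=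
        mul_nonpos_of_nonpos_of_nonneg (mul_nonpos_of_nonneg_of_nonpos (by positivity) hs)
          (by positivity)
      have : 0 ≤ m * u ^ (m + 1) := by positivity
      linarith
    rw [pow_succ v] at *
    rw [one_pow]
    linarith

lemma bregman_smul (m : ℕ) (b u a : ℝ) :
    bregman m (b * u) (b * a) = b ^ (m + 1) * bregman m u a := by
  unfold bregman; ring

/-- Joint convexity of the Bregman divergence, as the existence of a supporting hyperplane. -/
lemma exists_bregman_support (m : ℕ) (hm : 1 ≤ m) {v b : ℝ} (hv : 0 ≤ v) (hb : 0 ≤ b) :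
    ∃ c₁ c₂ : ℝ, ∀ u a : ℝ, 0 ≤ u → 0 ≤ a → (b = 0 → a = 0) →
      bregman m v b + c₁ * (u ^ m - v ^ m) + c₂ * (a ^ m - b ^ m) ≤ bregman m u a := by
  rcases hb.eq_or_lt with rfl | hb
  -- At `b = 0` the slope in `t` can be infinite. The hypothesis forces `a = 0`, so any value
  -- serves.
  · refine ⟨(m + 1) * v, 0, fun u a hu _ h => ?_⟩
    obtain rfl := h rfl
    have := young_pow m hv hu
    simp only [bregman, pow_succ v] at *
    simp
    linarith
  -- For `b > 0`, homogeneity of degree `m + 1` reduces to `b = 1`; the slopes are those of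
  -- `bregman_support_one` rescaled.
  · refine ⟨(m + 1) * (v - b), ((m + 1) / m) * (b - b * (v ^ m / b ^ m)), fun u a hu ha _ => ?_⟩
    have h := mul_le_mul_of_nonneg_left
      (bregman_support_one m hm (u := u / b) (a := a / b) (v := v / b)
        (by positivity) (by positivity) (by positivity)) (pow_nonneg hb.le (m + 1))
    have e := bregman_smul m b (u / b) (a / b)
    have e' := bregman_smul m b (v / b) 1
    rw [mul_div_cancel₀ _ hb.ne', mul_div_cancel₀ _ hb.ne'] at e
    rw [mul_div_cancel₀ _ hb.ne', mul_one] at e'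
    rw [← e, mul_add, mul_add, ← e'] at h
    refine le_trans (le_of_eq ?_) h
    simp only [div_pow]
    field_simp
    ring

/-! ### Calculus of bounded measurable functions. -/

/-- Bounded measurable real functions. -/
structure BddMeas {A : Type*} [MeasurableSpace A] (f : A → ℝ) : Prop where
  measurable : Measurable f
  bdd : ∃ C, ∀ x, |f x| ≤ C

namespace BddMeas

variable {A B : Type*} [MeasurableSpace A] [MeasurableSpace B] {f g : A → ℝ}

lemma integrable (hf : BddMeas f) (μ : Measure A) [IsFiniteMeasure μ] : Integrable f μ := by
  obtain ⟨C, hC⟩ := hf.bdd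
  exact Integrable.of_bound hf.measurable.aestronglyMeasurable C (ae_of_all _ hC)

lemma const (c : ℝ) : BddMeas (fun _ : A => c) := ⟨measurable_const, |c|, fun _ => le_rfl⟩

lemma add (hf : BddMeas f) (hg : BddMeas g) : BddMeas (fun x => f x + g x) := by
  obtain ⟨C, hC⟩ := hf.bdd
  obtain ⟨D, hD⟩ := hg.bdd
  exact ⟨hf.measurable.add hg.measurable, C + D, fun x =>
    (abs_add_le _ _).trans (add_le_add (hC x) (hD x))⟩

lemma neg (hf : BddMeas f) : BddMeas (fun x => -f x) := by
  obtain ⟨C, hC⟩ := hf.bdd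
  exact ⟨hf.measurable.neg, C, fun x => by simpa using hC x⟩

lemma sub (hf : BddMeas f) (hg : BddMeas g) : BddMeas (fun x => f x - g x) := by
  simpa only [sub_eq_add_neg] using hf.add hg.neg

lemma mul (hf : BddMeas f) (hg : BddMeas g) : BddMeas (fun x => f x * g x) := by
  obtain ⟨C, hC⟩ := hf.bdd
  obtain ⟨D, hD⟩ := hg.bdd
  refine ⟨hf.measurable.mul hg.measurable, C * D, fun x => ?_⟩
  rw [abs_mul]
  exact mul_le_mul (hC x) (hD x) (abs_nonneg _) ((abs_nonneg _).trans (hC x))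

lemma pow (hf : BddMeas f) (k : ℕ) : BddMeas (fun x => f x ^ k) := by
  obtain ⟨C, hC⟩ := hf.bdd
  refine ⟨hf.measurable.pow_const k, C ^ k, fun x => ?_⟩
  rw [abs_pow]
  exact pow_le_pow_left₀ (abs_nonneg _) (hC x) k

lemma rpow (hf : BddMeas f) (h0 : ∀ x, 0 ≤ f x) {r : ℝ} (hr : 0 ≤ r) :
    BddMeas (fun x => f x ^ r) := by
  obtain ⟨C, hC⟩ := hf.bdd
  refine ⟨hf.measurable.pow_const r, C ^ r, fun x => ?_⟩
  rw [abs_of_nonneg (Real.rpow_nonneg (h0 x) r)]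
  exact Real.rpow_le_rpow (h0 x) ((le_abs_self _).trans (hC x)) hr

lemma posPart (hf : BddMeas f) : BddMeas (fun x => (f x)⁺) := by
  obtain ⟨C, hC⟩ := hf.bdd
  refine ⟨hf.measurable.sup_const 0, C, fun x => ?_⟩
  rw [abs_of_nonneg (posPart_nonneg _)]
  exact (sup_le (le_abs_self _) (abs_nonneg _)).trans (hC x)

lemma comp (hf : BddMeas f) {φ : B → A} (hφ : Measurable φ) : BddMeas (fun x => f (φ x)) := by
  obtain ⟨C, hC⟩ := hf.bdd
  exact ⟨hf.measurable.comp hφ, C, fun x => hC _⟩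

lemma integral_right {f : A → B → ℝ} (hf : BddMeas (fun p : A × B => f p.1 p.2))
    (ν : Measure B) [IsProbabilityMeasure ν] : BddMeas (fun a => ∫ b, f a b ∂ν) := by
  obtain ⟨C, hC⟩ := hf.bdd
  refine ⟨(hf.measurable.stronglyMeasurable.integral_prod_right' (ν := ν)).measurable, C,
    fun a => ?_⟩
  have := norm_integral_le_of_norm_le_const (μ := ν) (f := fun b => f a b)
    (ae_of_all _ fun b => hC (a, b))
  simpa using this

lemma bregman {u a : A → ℝ} (hu : BddMeas u) (ha : BddMeas a) (m : ℕ) :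
    BddMeas (fun x => bregman m (u x) (a x)) :=
  (((const _).mul (hu.pow (m + 1))).add (ha.pow (m + 1))).sub
    (((const _).mul ha).mul (hu.pow m))

end BddMeas

/-! ### Entropy on a product of two spaces and in one coordinate. -/

/-- The `L^m` norm of a nonnegative function. -/
noncomputable def pnorm {A : Type*} [MeasurableSpace A] (m : ℕ) (μ : Measure A) (w : A → ℝ) : ℝ :=
  (∫ x, w x ^ m ∂μ) ^ ((m : ℝ)⁻¹)

section

variable {A B : Type*} [MeasurableSpace A] [MeasurableSpace B]

lemma integral_pow_nonneg (m : ℕ) (μ : Measure A) {w : A → ℝ} (h0 : ∀ x, 0 ≤ w x) :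
    0 ≤ ∫ x, w x ^ m ∂μ :=
  integral_nonneg fun x => pow_nonneg (h0 x) m

lemma pnorm_nonneg (m : ℕ) (μ : Measure A) {w : A → ℝ} (h0 : ∀ x, 0 ≤ w x) :
    0 ≤ pnorm m μ w := Real.rpow_nonneg (integral_pow_nonneg m μ h0) _

lemma pnorm_pow {m : ℕ} (hm : 1 ≤ m) (μ : Measure A) {w : A → ℝ} (h0 : ∀ x, 0 ≤ w x) :
    pnorm m μ w ^ m = ∫ x, w x ^ m ∂μ :=
  Real.rpow_inv_natCast_pow (integral_pow_nonneg m μ h0) (by omega)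

lemma BddMeas.pnorm_right {w : A → B → ℝ} (hw : BddMeas (fun p : A × B => w p.1 p.2))
    (h0 : ∀ a b, 0 ≤ w a b) (m : ℕ) (ν : Measure B) [IsProbabilityMeasure ν] :
    BddMeas (fun a => pnorm m ν (w a)) :=
  ((hw.pow m).integral_right (f := fun a b => w a b ^ m) ν).rpow
    (fun a => integral_pow_nonneg m ν (h0 a)) (by positivity)

/-- Jensen's inequality for the jointly convex divergence: integrate the supporting plane at the
means of `u^m` and `a^m`, where the linear terms vanish. -/
lemma bregman_pnorm_le {m : ℕ} (hm : 1 ≤ m) (μ : Measure A) [IsProbabilityMeasure μ]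
    {u a : A → ℝ} (hu : BddMeas u) (ha : BddMeas a) (hu0 : ∀ x, 0 ≤ u x) (ha0 : ∀ x, 0 ≤ a x) :
    bregman m (pnorm m μ u) (pnorm m μ a) ≤ ∫ x, bregman m (u x) (a x) ∂μ := by
  obtain ⟨c₁, c₂, h⟩ := exists_bregman_support m hm (pnorm_nonneg m μ hu0) (pnorm_nonneg m μ ha0)
  have hae : ∀ᵐ x ∂μ, pnorm m μ a = 0 → a x = 0 := by
    by_cases hb : pnorm m μ a = 0
    · have : ∫ x, a x ^ m ∂μ = 0 := by
        rw [← pnorm_pow hm μ ha0, hb, zero_pow (by omega)]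
      rw [integral_eq_zero_iff_of_nonneg (fun x => pow_nonneg (ha0 x) m)
        ((ha.pow m).integrable μ)] at this
      filter_upwards [this] with x hx _
      exact pow_eq_zero_iff (by omega : m ≠ 0) |>.1 hx
    · exact ae_of_all _ fun x h => absurd h hb
  have i₁ : BddMeas (fun x => c₁ * (u x ^ m - pnorm m μ u ^ m)) :=
    (BddMeas.const _).mul ((hu.pow m).sub (BddMeas.const _))
  have i₂ : BddMeas (fun x => c₂ * (a x ^ m - pnorm m μ a ^ m)) :=
    (BddMeas.const _).mul ((ha.pow m).sub (BddMeas.const _))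
  have key : ∫ x, (bregman m (pnorm m μ u) (pnorm m μ a) + c₁ * (u x ^ m - pnorm m μ u ^ m)
      + c₂ * (a x ^ m - pnorm m μ a ^ m)) ∂μ ≤ ∫ x, bregman m (u x) (a x) ∂μ := by
    refine integral_mono_ae ((((BddMeas.const _).add i₁).add i₂).integrable μ)
      ((hu.bregman ha m).integrable μ) ?_
    filter_upwards [hae] with x hx
    exact h (u x) (a x) (hu0 x) (ha0 x) hx
  rw [integral_add (((BddMeas.const _).add i₁).integrable μ) (i₂.integrable μ),
    integral_add ((BddMeas.const _).integrable μ) (i₁.integrable μ), integral_const_mul,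
    integral_const_mul, integral_sub ((hu.pow m).integrable μ) ((BddMeas.const _).integrable μ),
    integral_sub ((ha.pow m).integrable μ) ((BddMeas.const _).integrable μ),
    pnorm_pow hm μ hu0, pnorm_pow hm μ ha0] at key
  simpa using key

/-- Subadditivity of the entropy for two factors. Averaging in `x` contracts the divergence of `w`
from its marginal norm `a`. After integration in `y`, both sides are `m` times differences of
`(m+1)`-st moments. -/
lemma integral_pnorm_pow_add_le {m : ℕ} (hm : 1 ≤ m) (μ : Measure A) (ν : Measure B)
    [IsProbabilityMeasure μ] [IsProbabilityMeasure ν] {w : A → B → ℝ}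
    (hw : BddMeas (fun p : A × B => w p.1 p.2)) (h0 : ∀ a b, 0 ≤ w a b) :
    ∫ a, pnorm m ν (w a) ^ (m + 1) ∂μ + ∫ b, pnorm m μ (fun a => w a b) ^ (m + 1) ∂ν
      ≤ ∫ p : A × B, w p.1 p.2 ^ (m + 1) ∂(μ.prod ν)
        + pnorm m (μ.prod ν) (fun p => w p.1 p.2) ^ (m + 1) := by
  have hw' : BddMeas (fun p : B × A => w p.2 p.1) := hw.comp measurable_swap
  set a : A → ℝ := fun x => pnorm m ν (w x) with ha_def
  set v : B → ℝ := fun y => pnorm m μ (fun x => w x y) with hv_def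
  set b : ℝ := pnorm m (μ.prod ν) (fun p => w p.1 p.2) with hb_def
  have ha : BddMeas a := hw.pnorm_right h0 m ν
  have hv : BddMeas v := hw'.pnorm_right (w := fun y x => w x y) (fun y x => h0 x y) m μ
  have ha0 : ∀ x, 0 ≤ a x := fun x => pnorm_nonneg m ν (h0 x)
  have ham : ∀ x, a x ^ m = ∫ y, w x y ^ m ∂ν := fun x => pnorm_pow hm ν (h0 x)
  have hvm : ∀ y, v y ^ m = ∫ x, w x y ^ m ∂μ := fun y => pnorm_pow hm μ fun x => h0 x y
  have hbm : b ^ m = ∫ p : A × B, w p.1 p.2 ^ m ∂(μ.prod ν) :=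
    pnorm_pow hm _ fun p => h0 p.1 p.2
  have hab : ∫ x, a x ^ m ∂μ = b ^ m := by
    simp_rw [ham, hbm]
    rw [integral_prod _ ((hw.pow m).integrable _)]
  have hb0 : 0 ≤ b := pnorm_nonneg m _ fun p => h0 p.1 p.2
  -- The norm of the marginal norm is the full norm, so Jensen in `x` has the constant `b` as its
  -- second argument.
  have hpa : pnorm m μ a = b := by
    rw [pnorm, hab, Real.pow_rpow_inv_natCast hb0 (by omega)]
  have hvb : ∫ y, v y ^ m ∂ν = b ^ m := by
    simp_rw [hvm, hbm]
    rw [integral_prod_symm _ ((hw.pow m).integrable _)]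
  have hA2 : BddMeas (fun p : B × A => a p.2) := ha.comp measurable_snd
  have key : ∫ y, bregman m (v y) b ∂ν ≤ ∫ y, ∫ x, bregman m (w x y) (a x) ∂μ ∂ν := by
    refine integral_mono ((hv.bregman (BddMeas.const b) m).integrable ν)
      (((hw'.bregman hA2 m).integral_right
        (f := fun y x => bregman m (w x y) (a x)) μ).integrable ν) fun y => ?_
    have := bregman_pnorm_le hm μ (hw.comp (measurable_prodMk_right (y := y))) ha
      (fun x => h0 x y) ha0
    rw [hpa] at this
    exact this
  have e1 : ∫ y, bregman m (v y) b ∂ν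
      = m * ∫ y, v y ^ (m + 1) ∂ν + b ^ (m + 1) - (m + 1) * b * b ^ m := by
    unfold bregman
    rw [integral_sub ((((BddMeas.const _).mul (hv.pow (m + 1))).add (BddMeas.const _)).integrable ν)
      (((BddMeas.const _).mul (hv.pow m)).integrable ν),
      integral_add (((BddMeas.const _).mul (hv.pow (m + 1))).integrable ν)
        ((BddMeas.const _).integrable ν), integral_const_mul, integral_const_mul, hvb]
    simp
  have e2 : ∫ y, ∫ x, bregman m (w x y) (a x) ∂μ ∂ν
      = m * ∫ p : A × B, w p.1 p.2 ^ (m + 1) ∂(μ.prod ν) + ∫ x, a x ^ (m + 1) ∂μ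
        - (m + 1) * ∫ x, a x * a x ^ m ∂μ := by
    have hA1 : BddMeas (fun p : A × B => a p.1) := ha.comp measurable_fst
    have := (hw.bregman hA1 m).integrable (μ.prod ν)
    rw [← integral_prod_symm _ this]
    unfold bregman
    have i3 : BddMeas (fun p : A × B => (m + 1) * a p.1 * w p.1 p.2 ^ m) :=
      ((BddMeas.const _).mul hA1).mul (hw.pow m)
    rw [integral_sub ((((BddMeas.const _).mul (hw.pow (m + 1))).add
        (hA1.pow (m + 1))).integrable _) (i3.integrable _),
      integral_add (((BddMeas.const _).mul (hw.pow (m + 1))).integrable _)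
        ((hA1.pow (m + 1)).integrable _), integral_const_mul]
    congr 1
    · congr 1
      rw [integral_prod _ ((hA1.pow (m + 1)).integrable _)]
      simp
    · rw [integral_prod _ (i3.integrable _), ← integral_const_mul]
      refine integral_congr_ae (ae_of_all _ fun x => ?_)
      simp only
      rw [integral_const_mul, ham]
      ring
  rw [e1, e2] at key
  have hm' : (0 : ℝ) < m := by exact_mod_cast hm
  have e3 : ∫ x, a x * a x ^ m ∂μ = ∫ x, a x ^ (m + 1) ∂μ := by simp_rw [pow_succ, mul_comm]
  rw [e3] at key
  have key' : 0 ≤ m * (∫ p : A × B, w p.1 p.2 ^ (m + 1) ∂(μ.prod ν) + b ^ (m + 1)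
      - ∫ x, a x ^ (m + 1) ∂μ - ∫ y, v y ^ (m + 1) ∂ν) := by
    rw [pow_succ b] at *
    linarith
  have := nonneg_of_mul_nonneg_right key' hm'
  linarith

lemma integral_le_pnorm {m : ℕ} (hm : 1 ≤ m) (μ : Measure A) [IsProbabilityMeasure μ]
    {w : A → ℝ} (hw : BddMeas w) (h0 : ∀ x, 0 ≤ w x) : ∫ x, w x ∂μ ≤ pnorm m μ w := by
  refine (pow_le_pow_iff_left₀ (integral_nonneg h0) (pnorm_nonneg m μ h0)
    (by omega : m ≠ 0)).1 ?_
  rw [pnorm_pow hm μ h0]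
  exact (convexOn_pow m).map_integral_le (continuous_pow m).continuousOn isClosed_Ici
    (ae_of_all _ h0) (hw.integrable μ) ((hw.pow m).integrable μ)

/-- For `b ≤ a` this is the tangent bound `a^m - b^m ≤ m a^(m-1) (a - b)`; only one term on the
right is then active. -/
lemma sub_mul_pow_sub_pow_le {m : ℕ} (hm : 1 ≤ m) {a b : ℝ} (ha : 0 ≤ a) (hb : 0 ≤ b) :
    (a - b) * (a ^ m - b ^ m)
      ≤ m * a ^ (m - 1) * ((a - b)⁺) ^ 2 + m * b ^ (m - 1) * ((b - a)⁺) ^ 2 := by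
  wlog hab : b ≤ a generalizing a b
  · have := this hb ha (le_of_not_ge hab)
    linarith
  obtain ⟨k, rfl⟩ : ∃ k, m = k + 1 := ⟨m - 1, by omega⟩
  rw [posPart_of_nonneg (sub_nonneg.2 hab), posPart_of_nonpos (sub_nonpos.2 hab)]
  have h := mul_le_mul_of_nonneg_left (young_pow k hb ha) (sub_nonneg.2 hab)
  simp only [Nat.add_sub_cancel]
  push_cast
  rw [pow_succ a] at *
  linarith

/-- Since `E w ≤ ‖w‖_m`, the entropy is at most `E w^(m+1) - E w E w^m`, the covariance of `w` and
`w^m`. With an independent copy `w'` this equals half of `E (w - w')(w^m - w'^m)`. -/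
lemma integral_pow_sub_pnorm_pow_le {m : ℕ} (hm : 1 ≤ m) (μ : Measure A)
    [IsProbabilityMeasure μ] {w : A → ℝ} (hw : BddMeas w) (h0 : ∀ x, 0 ≤ w x) :
    ∫ x, w x ^ (m + 1) ∂μ - pnorm m μ w ^ (m + 1)
      ≤ ∫ x, ∫ y, m * w x ^ (m - 1) * ((w x - w y)⁺) ^ 2 ∂μ ∂μ := by
  have h1 : (∫ x, w x ∂μ) * ∫ x, w x ^ m ∂μ ≤ pnorm m μ w ^ (m + 1) := by
    rw [pow_succ', pnorm_pow hm μ h0]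
    exact mul_le_mul_of_nonneg_right (integral_le_pnorm hm μ hw h0) (integral_pow_nonneg m μ h0)
  have hw1 : BddMeas (fun p : A × A => w p.1) := hw.comp measurable_fst
  have hw2 : BddMeas (fun p : A × A => w p.2) := hw.comp measurable_snd
  set g : A × A → ℝ := fun p => w p.1 ^ (m + 1) - w p.1 * w p.2 ^ m with hg
  set h : A × A → ℝ := fun p => m * w p.1 ^ (m - 1) * ((w p.1 - w p.2)⁺) ^ 2 with hh
  have bg : BddMeas g := (hw1.pow _).sub (hw1.mul (hw2.pow m))
  have bh : BddMeas h := ((BddMeas.const _).mul (hw1.pow _)).mul (((hw1.sub hw2).posPart).pow 2)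
  have eg : ∫ p, g p ∂(μ.prod μ) = ∫ x, w x ^ (m + 1) ∂μ - (∫ x, w x ∂μ) * ∫ x, w x ^ m ∂μ := by
    rw [hg, integral_sub ((hw1.pow _).integrable _) ((hw1.mul (hw2.pow m)).integrable _),
      integral_prod_mul (fun x => w x) (fun y => w y ^ m),
      integral_prod _ ((hw1.pow _).integrable _)]
    simp
  have eh : ∫ p, h p ∂(μ.prod μ) = ∫ x, ∫ y, m * w x ^ (m - 1) * ((w x - w y)⁺) ^ 2 ∂μ ∂μ :=
    integral_prod _ (bh.integrable _)
  -- The pointwise bound holds only after symmetrization; swap invariance of `μ.prod μ` then makes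
  -- both sides twice the wanted integrals.
  have hle : ∫ p, (g p + g p.swap) ∂(μ.prod μ) ≤ ∫ p, (h p + h p.swap) ∂(μ.prod μ) := by
    refine integral_mono ((bg.add (bg.comp measurable_swap)).integrable _)
      ((bh.add (bh.comp measurable_swap)).integrable _) fun p => ?_
    have := sub_mul_pow_sub_pow_le hm (h0 p.1) (h0 p.2)
    simp only [hg, hh, Prod.fst_swap, Prod.snd_swap]
    rw [pow_succ (w p.1), pow_succ (w p.2)]
    linarith
  rw [integral_add (bg.integrable _) ((bg.comp measurable_swap).integrable _),
    integral_add (bh.integrable _) ((bh.comp measurable_swap).integrable _),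
    integral_prod_swap, integral_prod_swap, eg, eh] at hle
  linarith

end

/-! ### Tensorization over `n` coordinates. -/

section

variable {E : Type*} [MeasurableSpace E]

lemma measurable_finCons (n : ℕ) :
    Measurable (fun p : E × (Fin n → E) => (Fin.cons p.1 p.2 : Fin (n + 1) → E)) := by
  refine measurable_pi_iff.2 fun i => ?_
  refine Fin.cases ?_ (fun j => ?_) i
  · simpa using measurable_fst
  · simp only [Fin.cons_succ]
    exact (measurable_pi_apply j).comp measurable_snd

lemma measurable_update_prod {n : ℕ} (i : Fin n) :
    Measurable (fun p : (Fin n → E) × E => Function.update p.1 i p.2) := by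
  refine measurable_pi_iff.2 fun j => ?_
  by_cases h : j = i
  · subst h; simpa using measurable_snd
  · simp only [Function.update_of_ne h]
    exact (measurable_pi_apply j).comp measurable_fst

lemma map_finCons {n : ℕ} (μ : Fin (n + 1) → Measure E) [∀ i, IsProbabilityMeasure (μ i)] :
    ((μ 0).prod (Measure.pi fun j => μ j.succ)).map
      (fun p => (Fin.cons p.1 p.2 : Fin (n + 1) → E)) = Measure.pi μ := by
  have h := (measurePreserving_piFinSuccAbove μ 0).symm.map_eq
  simp only [Fin.zero_succAbove] at h
  rw [← h]
  congr 1
  funext p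
  simp only [MeasurableEquiv.piFinSuccAbove, MeasurableEquiv.symm_mk, MeasurableEquiv.coe_mk,
    Equiv.symm_symm, Fin.insertNthEquiv_zero]
  rfl

lemma integral_pi_succ {n : ℕ} (μ : Fin (n + 1) → Measure E) [∀ i, IsProbabilityMeasure (μ i)]
    {f : (Fin (n + 1) → E) → ℝ} (hf : BddMeas f) :
    ∫ x, f x ∂(Measure.pi μ)
      = ∫ p : E × (Fin n → E), f (Fin.cons p.1 p.2) ∂((μ 0).prod (Measure.pi fun j => μ j.succ)) := by
  rw [← map_finCons μ, integral_map (measurable_finCons n).aemeasurable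
    hf.measurable.aestronglyMeasurable]

/-- The integrand of the tensorization inequality. -/
noncomputable def localEnergy {n : ℕ} (m : ℕ) (w : (Fin n → E) → ℝ) (i : Fin n)
    (x : Fin n → E) (y : E) : ℝ :=
  m * w x ^ (m - 1) * ((w x - w (Function.update x i y))⁺) ^ 2

lemma BddMeas.localEnergy {n : ℕ} (m : ℕ) {w : (Fin n → E) → ℝ} (hw : BddMeas w) (i : Fin n) :
    BddMeas (fun p : (Fin n → E) × E => localEnergy m w i p.1 p.2) :=
  have hw1 : BddMeas (fun p : (Fin n → E) × E => w p.1) := hw.comp measurable_fst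
  ((BddMeas.const _).mul (hw1.pow _)).mul
    ((hw1.sub (hw.comp (measurable_update_prod i))).posPart.pow 2)

/-- Tensorization of the entropy associated with `y ↦ y ^ ((m + 1) / m)`. -/
theorem integral_pow_sub_pnorm_pow_le_sum {m : ℕ} (hm : 1 ≤ m) (n : ℕ) (μ : Fin n → Measure E)
    [∀ i, IsProbabilityMeasure (μ i)] {w : (Fin n → E) → ℝ} (hw : BddMeas w)
    (h0 : ∀ x, 0 ≤ w x) :
    ∫ x, w x ^ (m + 1) ∂(Measure.pi μ) - pnorm m (Measure.pi μ) w ^ (m + 1)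
      ≤ ∑ i, ∫ x, ∫ y, localEnergy m w i x y ∂(μ i) ∂(Measure.pi μ) := by
  induction n with
  | zero =>
    have hx : w = fun _ => w default := by
      funext x; rw [Subsingleton.elim x default]
    rw [hx]
    simp only [pnorm, integral_const, probReal_univ, one_smul, Finset.univ_eq_empty,
      Finset.sum_empty]
    rw [Real.pow_rpow_inv_natCast (h0 _) (by omega), sub_self]
  | succ n ih =>
    set ν : Measure (Fin n → E) := Measure.pi fun j => μ j.succ with hν
    set W : E → (Fin n → E) → ℝ := fun a β => w (Fin.cons a β) with hW
    have bW : BddMeas (fun p : E × (Fin n → E) => W p.1 p.2) := hw.comp (measurable_finCons n)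
    have W0 : ∀ a β, 0 ≤ W a β := fun a β => h0 _
    have bWa : ∀ a, BddMeas (W a) := fun a => bW.comp (measurable_prodMk_left (x := a))
    have bWb : ∀ β, BddMeas (fun a => W a β) := fun β =>
      bW.comp (measurable_prodMk_right (y := β))
    have bWs : BddMeas (fun p : (Fin n → E) × E => W p.2 p.1) := bW.comp measurable_swap
    -- The total entropy is at most the mean entropy in coordinate `0` plus the mean entropy in the
    -- others: `first` bounds the former, `second` the latter by induction.
    have hmain := integral_pnorm_pow_add_le hm (μ 0) ν bW W0
    have eN : pnorm m (Measure.pi μ) w = pnorm m ((μ 0).prod ν) (fun p => W p.1 p.2) := by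
      unfold pnorm
      rw [integral_pi_succ μ (hw.pow m)]
    have eI : ∫ x, w x ^ (m + 1) ∂(Measure.pi μ)
        = ∫ p : E × (Fin n → E), W p.1 p.2 ^ (m + 1) ∂((μ 0).prod ν) :=
      integral_pi_succ μ (hw.pow (m + 1))
    have bL : ∀ i, BddMeas (fun p : (Fin (n + 1) → E) => ∫ y, localEnergy m w i p y ∂(μ i)) :=
      fun i => (hw.localEnergy m i).integral_right (f := fun x y => localEnergy m w i x y) (μ i)
    rw [eN, eI, Fin.sum_univ_succ]
    have bI : BddMeas (fun a => ∫ β, W a β ^ (m + 1) ∂ν) :=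
      (bW.pow (m + 1)).integral_right (f := fun a β => W a β ^ (m + 1)) ν
    have bI' : BddMeas (fun β => ∫ a, W a β ^ (m + 1) ∂(μ 0)) :=
      (bWs.pow (m + 1)).integral_right (f := fun β a => W a β ^ (m + 1)) (μ 0)
    have bP : BddMeas (fun a => pnorm m ν (W a) ^ (m + 1)) := (bW.pnorm_right W0 m ν).pow (m + 1)
    have bP' : BddMeas (fun β => pnorm m (μ 0) (fun a => W a β) ^ (m + 1)) :=
      (bWs.pnorm_right (w := fun β a => W a β) (fun β a => W0 a β) m (μ 0)).pow (m + 1)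
    have first : ∫ p : E × (Fin n → E), W p.1 p.2 ^ (m + 1) ∂((μ 0).prod ν)
        - ∫ β, pnorm m (μ 0) (fun a => W a β) ^ (m + 1) ∂ν
        ≤ ∫ x, ∫ y, localEnergy m w 0 x y ∂(μ 0) ∂(Measure.pi μ) := by
      rw [integral_prod_symm _ ((bW.pow (m + 1)).integrable _),
        ← integral_sub (bI'.integrable ν) (bP'.integrable ν),
        integral_pi_succ μ (bL 0),
        integral_prod_symm _ (((bL 0).comp (measurable_finCons n)).integrable _)]
      refine integral_mono ((bI'.sub bP').integrable ν)
        ((((bL 0).comp (measurable_finCons n)).comp measurable_swap).integral_right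
          (f := fun β a => ∫ y, localEnergy m w 0 (Fin.cons a β) y ∂(μ 0)) (μ 0) |>.integrable ν)
        fun β => ?_
      have := integral_pow_sub_pnorm_pow_le hm (μ 0) (bWb β) fun a => W0 a β
      simpa only [localEnergy, Fin.update_cons_zero, hW] using this
    have second : ∫ p : E × (Fin n → E), W p.1 p.2 ^ (m + 1) ∂((μ 0).prod ν)
        - ∫ a, pnorm m ν (W a) ^ (m + 1) ∂(μ 0)
        ≤ ∑ i : Fin n, ∫ x, ∫ y, localEnergy m w i.succ x y ∂(μ i.succ) ∂(Measure.pi μ) := by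
      have bS : ∀ i : Fin n, BddMeas (fun a => ∫ β, ∫ y, localEnergy m w i.succ (Fin.cons a β) y
          ∂(μ i.succ) ∂ν) := fun i => ((bL i.succ).comp (measurable_finCons n)).integral_right
            (f := fun a β => ∫ y, localEnergy m w i.succ (Fin.cons a β) y ∂(μ i.succ)) ν
      have es : ∀ i : Fin n, ∫ x, ∫ y, localEnergy m w i.succ x y ∂(μ i.succ) ∂(Measure.pi μ)
          = ∫ a, ∫ β, ∫ y, localEnergy m w i.succ (Fin.cons a β) y ∂(μ i.succ) ∂ν ∂(μ 0) := by
        intro i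
        rw [integral_pi_succ μ (bL i.succ),
          integral_prod _ (((bL i.succ).comp (measurable_finCons n)).integrable _)]
      simp_rw [es]
      rw [integral_prod _ ((bW.pow (m + 1)).integrable _),
        ← integral_sub (bI.integrable _) (bP.integrable _),
        ← integral_finsetSum _ fun i _ => (bS i).integrable _]
      refine integral_mono ((bI.sub bP).integrable _)
        (integrable_finsetSum _ fun i _ => (bS i).integrable _) fun a => ?_
      have := ih (fun j => μ j.succ) (bWa a) (W0 a)
      simpa only [localEnergy, ← Fin.cons_update, hW] using this
    linarith

end

/-! ### The numerical inequality that determines `K`. -/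

/-- From `log (1 + x) ≥ 2x / (x + 2)` at `x = d/p`. This is sharp enough to keep the `1/m`
correction needed below. -/
lemma sqrt_div_pow_le {p d : ℝ} (hp : 0 < p) (hd : 0 ≤ d) (k : ℕ) :
    √(p / (p + d)) ^ k ≤ Real.exp (-(k * d / (2 * p + d))) := by
  have hlog := Real.le_log_one_add_of_nonneg (x := d / p) (by positivity)
  have e1 : 1 + d / p = (p / (p + d))⁻¹ := by field_simp
  have e2 : 2 * (d / p) / (d / p + 2) = 2 * (d / (2 * p + d)) := by field_simp; ring
  rw [e1, Real.log_inv, e2] at hlog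
  have hpos : 0 < p / (p + d) := by positivity
  have h : √(p / (p + d)) ≤ Real.exp (-(d / (2 * p + d))) := by
    rw [← Real.exp_log (Real.sqrt_pos.2 hpos), Real.log_sqrt hpos.le]
    exact Real.exp_le_exp.2 (by linarith)
  calc √(p / (p + d)) ^ k ≤ Real.exp (-(d / (2 * p + d))) ^ k :=
        pow_le_pow_left₀ (Real.sqrt_nonneg _) h k
    _ = Real.exp (-(k * d / (2 * p + d))) := by
        rw [← Real.exp_nat_mul]; ring_nf

lemma sqrt_exp_one : √(Real.exp 1) = Real.exp (1 / 2) := by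
  rw [← Real.log_injOn_pos.eq_iff (Real.sqrt_pos.2 (Real.exp_pos _)) (Real.exp_pos _),
    Real.log_sqrt (Real.exp_pos _).le, Real.log_exp, Real.log_exp]

lemma exp_half_sq : Real.exp (1 / 2) ^ 2 = Real.exp 1 := by
  rw [← Real.exp_nat_mul]; norm_num

lemma exp_half_le : Real.exp (1 / 2) ≤ 1.65 := by
  refine (pow_le_pow_iff_left₀ (Real.exp_pos _).le (by norm_num) two_ne_zero).1 ?_
  rw [exp_half_sq]
  have := Real.exp_one_lt_d9
  norm_num at this ⊢
  linarith

lemma le_exp_half : 1.6 ≤ Real.exp (1 / 2) := by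
  refine (pow_le_pow_iff_left₀ (by norm_num) (Real.exp_pos _).le two_ne_zero).1 ?_
  rw [exp_half_sq]
  have := Real.exp_one_gt_d9
  norm_num at this ⊢
  linarith

lemma inv_K : K⁻¹ = Real.exp (1 / 2) ^ 2 - Real.exp (1 / 2) := by
  rw [K, one_div, inv_inv, sqrt_exp_one, exp_half_sq]

lemma inv_K_le : K⁻¹ ≤ 1.2 := by
  have h1 := exp_half_le
  have h2 := le_exp_half
  rw [inv_K]
  nlinarith

lemma K_pos : 0 < K := by
  have h2 := le_exp_half
  rw [← inv_pos, inv_K]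
  nlinarith

lemma half_le_K : 1 / 2 ≤ K := by
  have h := K_pos
  have := mul_le_mul_of_nonneg_left inv_K_le h.le
  rw [mul_inv_cancel₀ h.ne'] at this
  linarith

lemma exp_le_of_le_half {z : ℝ} (h0 : 0 ≤ z) (h1 : z ≤ 1 / 2) : Real.exp z ≤ 1 + 1.3 * z := by
  have h := convexOn_exp.2 (Set.mem_univ (1 / 2)) (Set.mem_univ 0)
    (by linarith : 0 ≤ 2 * z) (by linarith : 0 ≤ 1 - 2 * z) (by ring)
  have e : (2 * z) • (1 / 2 : ℝ) + (1 - 2 * z) • (0 : ℝ) = z := by simp; ring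
  rw [e] at h
  simp only [smul_eq_mul, Real.exp_zero] at h
  nlinarith [exp_half_le]

/-- The two terms tend to `e^(-1/2)` and `e^(-1)/K`, whose sum is exactly `1`. The first-order
corrections in `1/(m+1)` therefore decide, and their total is negative. -/
lemma sqrt_pow_step_div (m : ℕ) (hm : 2 ≤ m) :
    √(m / (m + 1)) ^ (m + 1) + K⁻¹ * (m / (m + 1) * √((m - 1) / (m + 1)) ^ (m - 1)) ≤ 1 := by
  have hm' : (2 : ℝ) ≤ m := by exact_mod_cast hm
  set E := Real.exp (1 / 2) with hE
  have hE0 : 0 < E := Real.exp_pos _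
  have hA : √((m : ℝ) / (m + 1)) ^ (m + 1) ≤ E⁻¹ * (1 - 1 / (4 * (m + 1))) := by
    refine (sqrt_div_pow_le (by positivity) zero_le_one (m + 1)).trans ?_
    have e : -(((m + 1 : ℕ) : ℝ) * 1 / (2 * m + 1)) = -(1 / 2) + -(1 / (4 * m + 2)) := by
      push_cast; field_simp; ring
    rw [e, Real.exp_add, Real.exp_neg (1 / 2)]
    refine mul_le_mul_of_nonneg_left ?_ (by positivity)
    rw [Real.exp_neg]
    have h1 : 1 + 1 / (4 * (m : ℝ) + 2) ≤ Real.exp (1 / (4 * m + 2)) := by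
      linarith [Real.add_one_le_exp (1 / (4 * (m : ℝ) + 2))]
    refine (inv_anti₀ (by positivity) h1).trans ?_
    have e3 : (1 + 1 / (4 * (m : ℝ) + 2))⁻¹ = 1 - 1 / (4 * m + 3) := by
      field_simp; ring
    rw [e3]
    have : 1 / (4 * ((m : ℝ) + 1)) ≤ 1 / (4 * m + 3) :=
      one_div_le_one_div_of_le (by positivity) (by linarith)
    linarith
  have hB : (m : ℝ) / (m + 1) * √((m - 1) / (m + 1)) ^ (m - 1)
      ≤ (E ^ 2)⁻¹ * (1 + 0.3 / (m + 1)) := by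
    have h := sqrt_div_pow_le (p := (m : ℝ) - 1) (d := 2) (by linarith) zero_le_two (m - 1)
    have e : -(((m - 1 : ℕ) : ℝ) * 2 / (2 * ((m : ℝ) - 1) + 2)) = -1 + 1 / m := by
      rw [Nat.cast_sub (by omega)]; push_cast
      have : 2 * ((m : ℝ) - 1) + 2 = 2 * m := by ring
      rw [this]; field_simp; ring
    rw [e, Real.exp_add, Real.exp_neg, show (m : ℝ) - 1 + 2 = m + 1 by ring, ← exp_half_sq] at h
    have h2 := exp_le_of_le_half (z := 1 / (m : ℝ)) (by positivity)
      (one_div_le_one_div_of_le two_pos hm')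
    calc (m : ℝ) / (m + 1) * √((m - 1) / (m + 1)) ^ (m - 1)
        ≤ m / (m + 1) * ((E ^ 2)⁻¹ * (1 + 1.3 * (1 / m))) := by
          refine mul_le_mul_of_nonneg_left (h.trans ?_) (by positivity)
          exact mul_le_mul_of_nonneg_left h2 (by positivity)
      _ = (E ^ 2)⁻¹ * (1 + 0.3 / (m + 1)) := by field_simp; ring
  have hK0 : 0 ≤ K⁻¹ := (inv_pos.2 K_pos).le
  calc _ ≤ E⁻¹ * (1 - 1 / (4 * (m + 1))) + K⁻¹ * ((E ^ 2)⁻¹ * (1 + 0.3 / (m + 1))) :=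
        add_le_add hA (mul_le_mul_of_nonneg_left hB hK0)
    -- Uses `K⁻¹ / E² = 1 - E⁻¹`. The coefficient is `E⁻¹/4 - 0.3 (1 - E⁻¹)`, nonnegative because
    -- `0.55 / 1.65 = 1/3 > 0.3`.
    _ = 1 - (E⁻¹ * 0.55 - 0.3) / (m + 1) := by
        rw [inv_K, ← hE]; field_simp; ring
    _ ≤ 1 := by
        have : (1.65 : ℝ)⁻¹ ≤ E⁻¹ := inv_anti₀ hE0 exp_half_le
        have h3 : (0 : ℝ) ≤ E⁻¹ * 0.55 - 0.3 := by norm_num at this ⊢; linarith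
        have : 0 ≤ (E⁻¹ * 0.55 - 0.3) / ((m : ℝ) + 1) := by positivity
        linarith

lemma sqrt_pow_step (m : ℕ) (hm : 2 ≤ m) :
    √(m : ℝ) ^ (m + 1) + K⁻¹ * (m * √((m - 1 : ℕ) : ℝ) ^ (m - 1)) ≤ √((m + 1 : ℕ) : ℝ) ^ (m + 1) := by
  obtain ⟨k, rfl⟩ : ∃ k, m = k + 1 := ⟨m - 1, by omega⟩
  have h := sqrt_pow_step_div (k + 1) hm
  set Q : ℝ := ((k + 1 + 1 : ℕ) : ℝ) with hQ
  have hQ0 : 0 < Q := by positivity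
  have hs : 0 < √Q := Real.sqrt_pos.2 hQ0
  have eQ : ((k + 1 : ℕ) : ℝ) + 1 = Q := by rw [hQ]; push_cast; ring
  have ek : ((k + 1 : ℕ) : ℝ) - 1 = k := by push_cast; ring
  rw [eQ, ek, Real.sqrt_div (by positivity), Real.sqrt_div (by positivity), div_pow, div_pow] at h
  simp only [Nat.add_sub_cancel] at h ⊢
  have h2 := mul_le_mul_of_nonneg_right h (pow_nonneg hs.le (k + 1 + 1))
  refine le_trans (le_of_eq ?_) (h2.trans (le_of_eq (one_mul _)))
  have e3 : √Q ^ (k + 1 + 1) = √Q ^ k * Q := by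
    rw [add_assoc, pow_add, one_add_one_eq_two, Real.sq_sqrt hQ0.le]
  have hk : √Q ^ k ≠ 0 := (pow_pos hs k).ne'
  rw [add_mul, div_mul_cancel₀ _ (pow_pos hs _).ne', e3]
  congr 1
  field_simp

/-! ### Moment recursion for bounded `F`. -/

lemma integral_abs_le_sqrt {A : Type*} [MeasurableSpace A] (π : Measure A)
    [IsProbabilityMeasure π] {g : A → ℝ} {c : ℝ}
    (hg : BddMeas g) (h : ∫ x, g x ^ 2 ∂π ≤ c) : ∫ x, |g x| ∂π ≤ √c := by
  refine Real.le_sqrt_of_sq_le (le_trans ?_ h)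
  have := (convexOn_pow 2).map_integral_le (continuous_pow 2).continuousOn isClosed_Ici
    (ae_of_all π fun x => abs_nonneg (g x)) (hg.integrable _).abs
    (by simpa [Function.comp_def] using (hg.pow 2).integrable π)
  simpa using this

section

variable {E : Type*} [MeasurableSpace E] {n : ℕ} (μ : Fin n → Measure E)
  [∀ i, IsProbabilityMeasure (μ i)] {F : (Fin n → E) → ℝ} {c : ℝ}

/-- The tensorized bound with the local energies of `w` dominated by those of `F`. Hypothesis `hwF`
covers both uses: a translate of `F`, and the positive part of `F` minus its mean. -/
lemma integral_pow_succ_le (hF : BddMeas F)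
    (hv : ∀ᵐ x ∂(Measure.pi μ), ∑ i, ∫ y, ((F x - F (Function.update x i y))⁺) ^ 2 ∂(μ i) ≤ c)
    {w : (Fin n → E) → ℝ} (hw : BddMeas w) (h0 : ∀ x, 0 ≤ w x)
    (hwF : ∀ x x', (w x - w x')⁺ ≤ (F x - F x')⁺) {m : ℕ} (hm : 1 ≤ m) :
    ∫ x, w x ^ (m + 1) ∂(Measure.pi μ)
      ≤ pnorm m (Measure.pi μ) w ^ (m + 1) + m * c * ∫ x, w x ^ (m - 1) ∂(Measure.pi μ) := by
  have h := integral_pow_sub_pnorm_pow_le_sum hm n μ hw h0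
  have bL : ∀ i, BddMeas (fun x => ∫ y, localEnergy m w i x y ∂(μ i)) :=
    fun i => (hw.localEnergy m i).integral_right (f := fun x y => localEnergy m w i x y) (μ i)
  rw [← integral_finsetSum _ fun i _ => (bL i).integrable _] at h
  have h2 : ∫ x, ∑ i, ∫ y, localEnergy m w i x y ∂(μ i) ∂(Measure.pi μ)
      ≤ ∫ x, m * c * w x ^ (m - 1) ∂(Measure.pi μ) := by
    refine integral_mono_ae (integrable_finsetSum _ fun i _ => (bL i).integrable _)
      (((BddMeas.const _).mul (hw.pow _)).integrable _) ?_
    filter_upwards [hv] with x hx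
    have hpos : 0 ≤ m * w x ^ (m - 1) := mul_nonneg (Nat.cast_nonneg _) (pow_nonneg (h0 x) _)
    calc ∑ i, ∫ y, localEnergy m w i x y ∂(μ i)
        ≤ ∑ i, m * w x ^ (m - 1) * ∫ y, ((F x - F (Function.update x i y))⁺) ^ 2 ∂(μ i) := by
          refine Finset.sum_le_sum fun i _ => ?_
          rw [← integral_const_mul]
          have bF : BddMeas (fun y => F (Function.update x i y)) :=
            hF.comp (measurable_update x)
          refine integral_mono
            ((hw.localEnergy m i).comp (measurable_prodMk_left (x := x)) |>.integrable _)
            (((BddMeas.const _).mul ((((BddMeas.const _).sub bF).posPart).pow 2)).integrable _)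
            fun y => ?_
          exact mul_le_mul_of_nonneg_left
            (pow_le_pow_left₀ (posPart_nonneg _) (hwF _ _) 2) hpos
      _ ≤ m * w x ^ (m - 1) * c := by
          rw [← Finset.mul_sum]
          exact mul_le_mul_of_nonneg_left hx hpos
      _ = m * c * w x ^ (m - 1) := by ring
  rw [integral_const_mul] at h2
  linarith

/-- One-sided Efron–Stein inequality. -/
lemma integral_sq_sub_integral_le (hF : BddMeas F)
    (hv : ∀ᵐ x ∂(Measure.pi μ), ∑ i, ∫ y, ((F x - F (Function.update x i y))⁺) ^ 2 ∂(μ i) ≤ c) :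
    ∫ x, (F x - ∫ x', F x' ∂(Measure.pi μ)) ^ 2 ∂(Measure.pi μ) ≤ c := by
  obtain ⟨C, hC⟩ := hF.bdd
  set e := ∫ x', F x' ∂(Measure.pi μ) with he
  -- Shifting by the bound `C` makes the function nonnegative; the recursion with `m = 1` is then
  -- the variance bound.
  have hw : BddMeas (fun x => F x + C) := hF.add (BddMeas.const C)
  have h := integral_pow_succ_le μ hF hv hw (fun x => by linarith [neg_le_of_abs_le (hC x)])
    (fun x x' => by simp) le_rfl
  have e1 : pnorm 1 (Measure.pi μ) (fun x => F x + C) = e + C := by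
    simp only [pnorm, pow_one, Nat.cast_one, inv_one, Real.rpow_one]
    rw [integral_add (hF.integrable _) ((BddMeas.const C).integrable _)]
    simp [he]
  rw [e1] at h
  have hFC := hF.sub (BddMeas.const e)
  have e2 : ∫ x, (F x + C) ^ 2 ∂(Measure.pi μ)
      = ∫ x, (F x - e) ^ 2 ∂(Measure.pi μ) + (e + C) ^ 2 := by
    have : ∀ x, (F x + C) ^ 2 = (F x - e) ^ 2 + (2 * (e + C) * (F x - e) + (e + C) ^ 2) :=
      fun x => by ring
    simp_rw [this]
    rw [integral_add ((hFC.pow 2).integrable _)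
      ((((BddMeas.const _).mul hFC).add (BddMeas.const _)).integrable _),
      integral_add (((BddMeas.const _).mul hFC).integrable _) ((BddMeas.const _).integrable _),
      integral_const_mul, integral_sub (hF.integrable _) ((BddMeas.const _).integrable _)]
    simp [← he]
  norm_num at h
  rw [e2] at h
  linarith

lemma integral_posPart_pow_le (hc : 0 ≤ c) (hF : BddMeas F)
    (hv : ∀ᵐ x ∂(Measure.pi μ), ∑ i, ∫ y, ((F x - F (Function.update x i y))⁺) ^ 2 ∂(μ i) ≤ c)
    (k : ℕ) (hk : 1 ≤ k) :
    ∫ x, ((F x - ∫ x', F x' ∂(Measure.pi μ))⁺) ^ k ∂(Measure.pi μ) ≤ √(K * k * c) ^ k := by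
  set e := ∫ x', F x' ∂(Measure.pi μ) with he
  have hvar := integral_sq_sub_integral_le μ hF hv
  rw [← he] at hvar
  have hg : BddMeas (fun x => F x - e) := hF.sub (BddMeas.const e)
  have hW := hg.posPart
  have hK := K_pos
  have hKc : 0 ≤ K * c := mul_nonneg hK.le hc
  have hsq : ∀ k : ℕ, √(K * k * c) = √k * √(K * c) := fun k => by
    rw [← Real.sqrt_mul (Nat.cast_nonneg k)]; ring_nf
  have hwF : ∀ x x', ((F x - e)⁺ - (F x' - e)⁺)⁺ ≤ (F x - F x')⁺ := by
    intro x x'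
    refine sup_le ?_ (posPart_nonneg _)
    rw [sub_le_iff_le_add]
    refine sup_le ?_ (add_nonneg (posPart_nonneg _) (posPart_nonneg _))
    have h1 := le_posPart (F x - F x')
    have h2 := le_posPart (F x' - e)
    linarith
  induction k using Nat.strong_induction_on with
  | _ k ih =>
  -- The recursion for `k = m + 1` calls on `m` and `m - 1`, both at least `1`; hence two base
  -- cases.
  obtain rfl | rfl | hk3 : k = 1 ∨ k = 2 ∨ 3 ≤ k := by omega
  · have habs := integral_abs_le_sqrt _ hg hvar
    -- A centred variable has positive part of mean half its absolute mean, so the first moment is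
    -- at most `√c / 2`.
    have e1 : ∫ x, |F x - e| ∂(Measure.pi μ) = 2 * ∫ x, (F x - e)⁺ ∂(Measure.pi μ) := by
      have : ∀ x, |F x - e| = 2 * (F x - e)⁺ - (F x - e) := fun x => by
        have h1 := posPart_sub_negPart (F x - e)
        have h2 := posPart_add_negPart (F x - e)
        linarith
      simp_rw [this]
      rw [integral_sub (((BddMeas.const 2).mul hW).integrable _) (hg.integrable _),
        integral_const_mul, integral_sub (hF.integrable _) ((BddMeas.const _).integrable _)]
      simp [← he]
    have h4 : √c ≤ 2 * √(K * c) := by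
      refine (Real.sqrt_le_left (by positivity)).2 ?_
      rw [mul_pow, Real.sq_sqrt hKc]
      nlinarith [half_le_K]
    simp only [pow_one, Nat.cast_one, mul_one]
    linarith
  · rw [Real.sq_sqrt (by positivity)]
    have h1 : ∫ x, ((F x - e)⁺) ^ 2 ∂(Measure.pi μ) ≤ ∫ x, (F x - e) ^ 2 ∂(Measure.pi μ) := by
      refine integral_mono ((hW.pow 2).integrable _) ((hg.pow 2).integrable _) fun x => ?_
      rw [← sq_abs (F x - e)]
      exact pow_le_pow_left₀ (posPart_nonneg _) (sup_le (le_abs_self _) (abs_nonneg _)) 2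
    have := half_le_K
    push_cast
    nlinarith
  · obtain ⟨m, rfl⟩ : ∃ m, k = m + 1 := ⟨k - 1, by omega⟩
    have hm : 2 ≤ m := by omega
    have h1 := ih m (by omega) (by omega)
    have h2 := ih (m - 1) (by omega) (by omega)
    have hstep := integral_pow_succ_le μ hF hv hW (fun x => posPart_nonneg _) hwF
      (m := m) (by omega)
    have hp : pnorm m (Measure.pi μ) (fun x => (F x - e)⁺) ≤ √(K * m * c) := by
      refine (pow_le_pow_iff_left₀ (pnorm_nonneg _ _ fun x => posPart_nonneg _)
        (Real.sqrt_nonneg _) (by omega : m ≠ 0)).1 ?_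
      rw [pnorm_pow (by omega) _ fun x => posPart_nonneg _]
      exact h1
    have hconst := mul_le_mul_of_nonneg_right (sqrt_pow_step m hm)
      (pow_nonneg (Real.sqrt_nonneg (K * c)) (m + 1))
    have h3 := pow_le_pow_left₀ (pnorm_nonneg _ _ fun x => posPart_nonneg _) hp (m + 1)
    have h4 := mul_le_mul_of_nonneg_left h2 (mul_nonneg (Nat.cast_nonneg m) hc)
    refine hstep.trans ((add_le_add h3 h4).trans (le_trans (le_of_eq ?_) (hconst.trans_eq ?_)))
    · obtain ⟨j, rfl⟩ : ∃ j, m = j + 1 := ⟨m - 1, by omega⟩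
      have ec : √(K * c) ^ (j + 1 + 1) = √(K * c) ^ j * (K * c) := by
        rw [add_assoc, pow_add, one_add_one_eq_two, Real.sq_sqrt hKc]
      rw [hsq, hsq, mul_pow, mul_pow, add_mul]
      simp only [Nat.add_sub_cancel]
      rw [ec]
      field_simp
    · rw [hsq, mul_pow]

end

/-! ### Removal of boundedness by truncation. -/

/-- Truncation to `[-N, N]`. -/
def clamp (N : ℕ) (t : ℝ) : ℝ := max (-N) (min t N)

lemma measurable_clamp (N : ℕ) : Measurable (clamp N) := by
  unfold clamp; fun_prop

lemma abs_clamp_le (N : ℕ) (t : ℝ) : |clamp N t| ≤ N := by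
  have : (0 : ℝ) ≤ N := Nat.cast_nonneg N
  exact abs_le.2 ⟨le_max_left _ _, max_le (by linarith) (min_le_right _ _)⟩

lemma abs_clamp_le_abs (N : ℕ) (t : ℝ) : |clamp N t| ≤ |t| := by
  have h : (0 : ℝ) ≤ N := Nat.cast_nonneg N
  refine abs_le.2 ⟨?_, max_le (by linarith [abs_nonneg t]) ((min_le_left _ _).trans (le_abs_self t))⟩
  rw [clamp, le_max_iff, le_min_iff]
  right
  exact ⟨neg_abs_le t, by linarith [abs_nonneg t]⟩

lemma posPart_clamp_sub_le (N : ℕ) (s t : ℝ) : (clamp N s - clamp N t)⁺ ≤ (s - t)⁺ := by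
  refine sup_le ?_ (posPart_nonneg _)
  rcases le_total s t with h | h
  · have : clamp N s ≤ clamp N t := max_le_max le_rfl (min_le_min h le_rfl)
    linarith [posPart_nonneg (s - t)]
  · refine le_trans ?_ (le_posPart _)
    unfold clamp
    rcases max_cases (-(N : ℝ)) (min s N) with h1 | h1 <;>
      rcases max_cases (-(N : ℝ)) (min t N) with h2 | h2 <;>
      rcases min_cases s (N : ℝ) with h3 | h3 <;> rcases min_cases t (N : ℝ) with h4 | h4 <;>
      linarith

lemma clamp_eq_self {N : ℕ} {t : ℝ} (h : |t| ≤ N) : clamp N t = t := by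
  obtain ⟨h1, h2⟩ := abs_le.1 h
  rw [clamp, min_eq_left h2, max_eq_right h1]

lemma tendsto_clamp (t : ℝ) : Filter.Tendsto (fun N => clamp N t) Filter.atTop (nhds t) := by
  obtain ⟨M, hM⟩ := exists_nat_ge |t|
  refine tendsto_const_nhds.congr' ?_
  filter_upwards [Filter.eventually_ge_atTop M] with N hN
  exact (clamp_eq_self (hM.trans (by exact_mod_cast hN))).symm

section

variable {A : Type*} [MeasurableSpace A]

lemma BddMeas.clamp {F : A → ℝ} (hF : Measurable F) (N : ℕ) :
    BddMeas (fun x => clamp N (F x)) :=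
  ⟨(measurable_clamp N).comp hF, N, fun x => abs_clamp_le N (F x)⟩

lemma exists_half_le_measure_abs_le (π : Measure A) [IsProbabilityMeasure π] {F : A → ℝ} :
    ∃ M : ℕ, 1 / 2 ≤ π.real {x | |F x| ≤ M} := by
  have hmono : Monotone fun M : ℕ => {x | |F x| ≤ M} := fun M N h x hx => by
    have h' : (M : ℝ) ≤ N := by exact_mod_cast h
    have hx' : |F x| ≤ M := hx
    exact hx'.trans h'
  have h := tendsto_measure_iUnion_atTop (μ := π) hmono
  have hu : ⋃ M : ℕ, {x | |F x| ≤ M} = Set.univ :=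
    Set.eq_univ_of_forall fun x => Set.mem_iUnion.2 (exists_nat_ge |F x|)
  rw [hu, measure_univ] at h
  obtain ⟨M, hM⟩ := (h.eventually (lt_mem_nhds (by norm_num : (2⁻¹ : ℝ≥0∞) < 1))).exists
  refine ⟨M, ?_⟩
  have := ENNReal.toReal_mono (measure_ne_top π _) hM.le
  simpa [Measure.real] using this

/-- A variance bound does not control the means of the truncations by itself. A level `M` with `|F|
≤ M` of probability at least `1/2` does: a mean far beyond `M` would force a large variance. Fatou's
lemma then bounds the `L¹` norm of `F`. -/
lemma integrable_of_variance_clamp_le (π : Measure A) [IsProbabilityMeasure π] {F : A → ℝ}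
    (hF : Measurable F) {c : ℝ}
    (hvar : ∀ N : ℕ, ∫ x, (clamp N (F x) - ∫ x', clamp N (F x') ∂π) ^ 2 ∂π ≤ c) :
    Integrable F π := by
  obtain ⟨M, hM⟩ := exists_half_le_measure_abs_le π (F := F)
  have hS : MeasurableSet {x | |F x| ≤ (M : ℝ)} := measurableSet_le hF.abs measurable_const
  have hbound : ∀ N : ℕ, eLpNorm (fun x => clamp N (F x)) 1 π
      ≤ ENNReal.ofReal (√c + (M + √(2 * c))) := by
    intro N
    have hG := BddMeas.clamp hF N
    set e := ∫ x', clamp N (F x') ∂π with he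
    have hg := hG.sub (BddMeas.const e)
    have hmean : |e| ≤ M + √(2 * c) := by
      rcases le_total |e| M with h | h
      · linarith [Real.sqrt_nonneg (2 * c)]
      · have h1 : π.real {x | |F x| ≤ (M : ℝ)} * (|e| - M) ^ 2 ≤ c := by
          refine le_trans ?_ (hvar N)
          rw [← smul_eq_mul, ← setIntegral_const]
          refine le_trans ?_ (setIntegral_le_integral (s := {x | |F x| ≤ (M : ℝ)}) ((hg.pow 2).integrable π)
            (ae_of_all _ fun x => sq_nonneg _))
          refine setIntegral_mono_on (integrable_const _).integrableOn
            ((hg.pow 2).integrable π).integrableOn hS fun x hx => ?_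
          rw [← sq_abs (clamp N (F x) - e)]
          refine pow_le_pow_left₀ (sub_nonneg.2 h) ?_ 2
          have h2 : |clamp N (F x)| ≤ M := (abs_clamp_le_abs _ _).trans hx
          have h3 := abs_sub_abs_le_abs_sub e (clamp N (F x))
          rw [abs_sub_comm] at h3
          linarith
        have h2 : (|e| - M) ^ 2 ≤ 2 * c := by nlinarith [sq_nonneg (|e| - M)]
        linarith [Real.le_sqrt_of_sq_le h2]
    rw [eLpNorm_one_eq_lintegral_enorm, ← ofReal_integral_norm_eq_lintegral_enorm
      (hG.integrable π)]
    refine ENNReal.ofReal_le_ofReal ?_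
    have h4 := integral_abs_le_sqrt π hg (hvar N)
    have h5 : ∫ x, ‖clamp N (F x)‖ ∂π ≤ ∫ x, (|clamp N (F x) - e| + |e|) ∂π := by
      refine integral_mono (hG.integrable π).norm
        ((hg.integrable π).abs.add (integrable_const _)) fun x => ?_
      have := abs_add_le (clamp N (F x) - e) e
      simpa using this
    rw [integral_add (hg.integrable π).abs (integrable_const _)] at h5
    simp only [integral_const, probReal_univ, one_smul] at h5
    linarith
  have hle := Lp.eLpNorm_le_of_ae_tendsto (p := 1) (μ := π) (g := F)
    (Filter.Eventually.of_forall hbound)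
    (fun N => (BddMeas.clamp hF N).measurable.aestronglyMeasurable)
    (ae_of_all _ fun x => tendsto_clamp (F x))
  rw [← memLp_one_iff_integrable]
  exact ⟨hF.aestronglyMeasurable, hle.trans_lt ENNReal.ofReal_lt_top⟩

lemma eLpNorm_le_of_integral_pow_le (π : Measure A) [IsProbabilityMeasure π] {w : A → ℝ}
    (hw : BddMeas w) (h0 : ∀ x, 0 ≤ w x) {q : ℕ} (hq : 1 ≤ q) {s : ℝ} (hs : 0 ≤ s)
    (h : ∫ x, w x ^ q ∂π ≤ s ^ q) : eLpNorm w q π ≤ ENNReal.ofReal s := by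
  obtain ⟨C, hC⟩ := hw.bdd
  have hmem : MemLp w q π := MemLp.of_bound hw.measurable.aestronglyMeasurable C (ae_of_all _ hC)
  rw [hmem.eLpNorm_eq_integral_rpow_norm (by positivity) (ENNReal.natCast_ne_top q)]
  refine ENNReal.ofReal_le_ofReal ?_
  simp only [ENNReal.toReal_natCast, Real.rpow_natCast, Real.norm_eq_abs, abs_of_nonneg (h0 _)]
  calc (∫ x, w x ^ q ∂π) ^ (q : ℝ)⁻¹ ≤ (s ^ q) ^ (q : ℝ)⁻¹ :=
        Real.rpow_le_rpow (integral_pow_nonneg q π h0) h (by positivity)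
    _ = s := Real.pow_rpow_inv_natCast hs (by omega)

end

section

variable {E : Type*} [MeasurableSpace E] {n : ℕ} (μ : Fin n → Measure E)
  [∀ i, IsProbabilityMeasure (μ i)] {F : (Fin n → E) → ℝ} {c : ℝ}

/-- Truncation is monotone and 1-Lipschitz, so it preserves the bound on the local energies. The
means converge by dominated convergence, and Fatou's lemma passes the moment bounds to the limit. -/
theorem eLpNorm_posPart_sub_integral_le (hc : 0 ≤ c) (hF : Measurable F)
    (hv : ∀ᵐ x ∂(Measure.pi μ),
      ∑ i, ∫⁻ y, ENNReal.ofReal (((F x - F (Function.update x i y))⁺) ^ 2) ∂(μ i)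
        ≤ ENNReal.ofReal c) :
    Integrable F (Measure.pi μ) ∧ ∀ q : ℕ, 1 ≤ q →
      eLpNorm (fun x => (F x - ∫ x', F x' ∂(Measure.pi μ))⁺) q (Measure.pi μ)
        ≤ ENNReal.ofReal (√(K * q * c)) := by
  have hvN : ∀ N : ℕ, ∀ᵐ x ∂(Measure.pi μ),
      ∑ i, ∫ y, ((clamp N (F x) - clamp N (F (Function.update x i y)))⁺) ^ 2 ∂(μ i) ≤ c := by
    intro N
    filter_upwards [hv] with x hx
    have hG := BddMeas.clamp hF N
    have hb : ∀ i, BddMeas fun y =>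
        ((clamp N (F x) - clamp N (F (Function.update x i y)))⁺) ^ 2 := fun i =>
      ((BddMeas.const _).sub (hG.comp (measurable_update x))).posPart.pow 2
    rw [← ENNReal.ofReal_le_ofReal_iff hc, ENNReal.ofReal_sum_of_nonneg fun i _ =>
      integral_nonneg fun y => sq_nonneg _]
    refine le_trans (Finset.sum_le_sum fun i _ => ?_) hx
    rw [ofReal_integral_eq_lintegral_ofReal ((hb i).integrable _)
      (ae_of_all _ fun y => sq_nonneg _)]
    exact lintegral_mono fun y => ENNReal.ofReal_le_ofReal
      (pow_le_pow_left₀ (posPart_nonneg _) (posPart_clamp_sub_le N _ _) 2)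
  have hint : Integrable F (Measure.pi μ) := integrable_of_variance_clamp_le _ hF fun N =>
    integral_sq_sub_integral_le μ (BddMeas.clamp hF N) (hvN N)
  refine ⟨hint, fun q hq => ?_⟩
  have hmean : Filter.Tendsto (fun N : ℕ => ∫ x, clamp N (F x) ∂(Measure.pi μ)) Filter.atTop
      (nhds (∫ x, F x ∂(Measure.pi μ))) :=
    tendsto_integral_of_dominated_convergence (fun x => |F x|)
      (fun N => (BddMeas.clamp hF N).measurable.aestronglyMeasurable) hint.abs
      (fun N => ae_of_all _ fun x => abs_clamp_le_abs N (F x))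
      (ae_of_all _ fun x => tendsto_clamp (F x))
  have hb : ∀ N : ℕ, BddMeas fun x => (clamp N (F x) - ∫ x', clamp N (F x') ∂(Measure.pi μ))⁺ :=
    fun N => ((BddMeas.clamp hF N).sub (BddMeas.const _)).posPart
  refine Lp.eLpNorm_le_of_ae_tendsto (u := Filter.atTop) (p := q) (μ := Measure.pi μ)
    (Filter.Eventually.of_forall fun N => eLpNorm_le_of_integral_pow_le _ (hb N)
      (fun x => posPart_nonneg _) hq (Real.sqrt_nonneg _)
      (integral_posPart_pow_le μ hc (BddMeas.clamp hF N) (hvN N) q hq))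
    (fun N => (hb N).measurable.aestronglyMeasurable) (ae_of_all _ fun x => ?_)
  exact ((tendsto_clamp (F x)).sub hmean).sup_nhds tendsto_const_nhds

end

/-! ### From product measures to random variables. -/

lemma Z_neg {Ω E : Type*} {n : ℕ} (F : (Fin n → E) → ℝ) (X : Fin n → Ω → E) (ω : Ω) :
    Z (fun x => -F x) X ω = -Z F X ω := rfl

lemma indepFun_vector_copy {Ω E : Type*} [MeasurableSpace Ω] [MeasurableSpace E] {P : Measure Ω}
    {n : ℕ} {X X' : Fin n → Ω → E} (hX : ∀ i, Measurable (X i)) (hX' : ∀ i, Measurable (X' i))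
    (hindep : iIndepFun (Sum.elim X X') P) (i : Fin n) :
    IndepFun (fun ω j => X j ω) (X' i) P := by
  classical
  have h := hindep.indepFun_finset (Finset.univ.image Sum.inl) {Sum.inr i}
    (by simp) (by rintro (j | j) <;> simp [hX, hX'])
  have hφ : Measurable fun (g : ↥(Finset.univ.image (Sum.inl : Fin n → Fin n ⊕ Fin n)) → E)
      (j : Fin n) => g ⟨Sum.inl j, Finset.mem_image_of_mem _ (Finset.mem_univ j)⟩ :=
    measurable_pi_iff.2 fun j => measurable_pi_apply _
  have hψ : Measurable fun (g : ↥({Sum.inr i} : Finset (Fin n ⊕ Fin n)) → E) =>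
      g ⟨Sum.inr i, Finset.mem_singleton_self _⟩ := measurable_pi_apply _
  exact h.comp hφ hψ

/-- The two parts have disjoint supports, so their `q`-th moments add; this is the source of the
factor `2^(1/q)`. -/
lemma eLpNorm_le_of_posPart_of_negPart {Ω : Type*} [MeasurableSpace Ω] {P : Measure Ω}
    {f : Ω → ℝ} (hf : Measurable f) {q : ℕ} (hq : 1 ≤ q)
    {s : ℝ} (hp : eLpNorm (fun ω => (f ω)⁺) q P ≤ ENNReal.ofReal s)
    (hn : eLpNorm (fun ω => (f ω)⁻) q P ≤ ENNReal.ofReal s) :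
    eLpNorm f q P ≤ ENNReal.ofReal ((2 : ℝ) ^ (1 / (q : ℝ)) * s) := by
  have hq0 : (q : NNReal) ≠ 0 := by positivity
  have hqr : (0 : ℝ) < q := by positivity
  have hq1 : q ≠ 0 := by omega
  have key : ∀ g : Ω → ℝ, eLpNorm g q P ^ (q : ℝ) = ∫⁻ ω, ‖g ω‖ₑ ^ (q : ℝ) ∂P := fun g => by
    simpa using eLpNorm_nnreal_pow_eq_lintegral (μ := P) (f := g) hq0
  have hm : Measurable fun ω => (f ω)⁺ := hf.sup_const 0
  have hsum : eLpNorm f q P ^ (q : ℝ)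
      = eLpNorm (fun ω => (f ω)⁺) q P ^ (q : ℝ) + eLpNorm (fun ω => (f ω)⁻) q P ^ (q : ℝ) := by
    rw [key, key, key, ← lintegral_add_left (hm.enorm.pow_const _)]
    refine lintegral_congr fun ω => ?_
    rcases le_total 0 (f ω) with h | h
    · rw [posPart_of_nonneg h, negPart_of_nonneg h]; simp [hq1]
    · rw [posPart_of_nonpos h, negPart_of_nonpos h]; simp [hq1]
  rw [← ENNReal.rpow_le_rpow_iff hqr, hsum, ENNReal.ofReal_mul (by positivity),
    ENNReal.mul_rpow_of_nonneg _ _ hqr.le, ENNReal.ofReal_rpow_of_nonneg (by positivity) hqr.le,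
    ← Real.rpow_mul zero_le_two, one_div, inv_mul_cancel₀ hqr.ne', Real.rpow_one,
    ENNReal.ofReal_ofNat, two_mul]
  exact add_le_add (ENNReal.rpow_le_rpow hp hqr.le) (ENNReal.rpow_le_rpow hn hqr.le)

section

variable {Ω E : Type*} [MeasurableSpace Ω] [MeasurableSpace E] {P : Measure Ω}
  [IsProbabilityMeasure P] {n : ℕ} {X X' : Fin n → Ω → E}

lemma map_vector_eq_pi (hX : ∀ i, Measurable (X i)) (hindep : iIndepFun (Sum.elim X X') P) :
    P.map (fun ω j => X j ω) = Measure.pi fun i => P.map (X i) :=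
  (iIndepFun_iff_map_fun_eq_pi_map fun i => (hX i).aemeasurable).1
    (iIndepFun.precomp (f := Sum.elim X X') Sum.inl_injective hindep)

lemma map_vector_copy_eq_prod (hX : ∀ i, Measurable (X i)) (hX' : ∀ i, Measurable (X' i))
    (hindep : iIndepFun (Sum.elim X X') P) (hcopy : ∀ i, IdentDistrib (X' i) (X i) P P)
    (i : Fin n) :
    P.map (fun ω => ((fun j => X j ω : Fin n → E), X' i ω))
      = (Measure.pi fun i => P.map (X i)).prod (P.map (X i)) := by
  rw [(indepFun_vector_copy hX hX' hindep i).map_prod_eq_prod_map_map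
    (measurable_pi_iff.2 hX).aemeasurable (hX' i).aemeasurable, map_vector_eq_pi hX hindep,
    (hcopy i).map_eq]

/-- A bound on the conditional expectation given `(X₁, …, Xₙ)` as a bound on partial integrals. -/
lemma ae_sum_lintegral_le_of_condLExp_le (hX : ∀ i, Measurable (X i))
    (hX' : ∀ i, Measurable (X' i)) (hindep : iIndepFun (Sum.elim X X') P)
    (hcopy : ∀ i, IdentDistrib (X' i) (X i) P P) (h : Fin n → (Fin n → E) × E → ℝ≥0∞)
    (hh : ∀ i, Measurable (h i)) (c : ℝ≥0∞)
    (hle : ∀ᵐ ω ∂P, condLExp (sigmaX X) P (fun ω => ∑ i, h i (fun j => X j ω, X' i ω)) ω ≤ c) :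
    ∀ᵐ x ∂(Measure.pi fun i => P.map (X i)), ∑ i, ∫⁻ y, h i (x, y) ∂(P.map (X i)) ≤ c := by
  have hXm : Measurable (fun ω (j : Fin n) => X j ω) := measurable_pi_iff.2 hX
  have : ∀ i, IsProbabilityMeasure (P.map (X i)) := fun i =>
    Measure.isProbabilityMeasure_map (hX i).aemeasurable
  -- It is enough to integrate over each measurable `S`: its preimage under the vector lies in
  -- `sigmaX X`, and `(X, X'ᵢ)` has the product law.
  refine ae_le_of_forall_setLIntegral_le_of_sigmaFinite
    (Finset.measurable_sum _ fun i _ => (hh i).lintegral_prod_right') fun S hS _ => ?_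
  have hpre : MeasurableSet[sigmaX X] ((fun ω (j : Fin n) => X j ω) ⁻¹' S) := ⟨S, hS, rfl⟩
  have hterm : ∀ i, ∫⁻ x in S, ∫⁻ y, h i (x, y) ∂(P.map (X i)) ∂(Measure.pi fun i => P.map (X i))
      = ∫⁻ ω in (fun ω (j : Fin n) => X j ω) ⁻¹' S, h i (fun j => X j ω, X' i ω) ∂P := by
    intro i
    have hpair : Measurable fun ω => ((fun j => X j ω : Fin n → E), X' i ω) := hXm.prodMk (hX' i)
    have hSU : MeasurableSet (S ×ˢ (Set.univ : Set E)) := hS.prod MeasurableSet.univ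
    rw [← lintegral_prod _ (hh i).aemeasurable]
    have er : ((Measure.pi fun i => P.map (X i)).restrict S).prod (P.map (X i))
        = ((Measure.pi fun i => P.map (X i)).prod (P.map (X i))).restrict (S ×ˢ Set.univ) := by
      rw [← Measure.prod_restrict, Measure.restrict_univ]
    rw [er, ← map_vector_copy_eq_prod hX hX' hindep hcopy i,
      setLIntegral_map hSU (hh i) hpair]
    congr 2
    ext ω
    simp
  rw [lintegral_finsetSum _ fun i _ => (hh i).lintegral_prod_right']
  simp_rw [hterm]
  have hm : ∀ i, Measurable fun ω => h i (fun j => X j ω, X' i ω) := fun i =>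
    (hh i).comp (hXm.prodMk (hX' i))
  rw [← lintegral_finsetSum _ fun i _ => hm i, ← setLIntegral_condLExp hXm.comap_le P _ hpre]
  refine (lintegral_mono_ae (ae_restrict_of_ae hle)).trans ?_
  rw [lintegral_const, lintegral_const, Measure.restrict_apply_univ, Measure.restrict_apply_univ,
    ← map_vector_eq_pi hX hindep, Measure.map_apply hXm hS]

lemma eLpNorm_posPart_Z_le (hX : ∀ i, Measurable (X i))
    (hX' : ∀ i, Measurable (X' i)) (hindep : iIndepFun (Sum.elim X X') P)
    (hcopy : ∀ i, IdentDistrib (X' i) (X i) P P) {F : (Fin n → E) → ℝ} (hF : Measurable F)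
    {c : ℝ} (hc : 0 ≤ c) (hV : ∀ᵐ ω ∂P, Vplus P F X X' ω ≤ ENNReal.ofReal c) :
    Integrable (Z F X) P ∧ ∀ q : ℕ, 2 ≤ q →
      eLpNorm (fun ω => (Z F X ω - ∫ ω', Z F X ω' ∂P)⁺) q P ≤ ENNReal.ofReal (√(K * q * c)) := by
  have hXm : Measurable (fun ω (j : Fin n) => X j ω) := measurable_pi_iff.2 hX
  have : ∀ i, IsProbabilityMeasure (P.map (X i)) := fun i =>
    Measure.isProbabilityMeasure_map (hX i).aemeasurable
  have hv := ae_sum_lintegral_le_of_condLExp_le hX hX' hindep hcopy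
    (fun i p => ENNReal.ofReal (((F p.1 - F (Function.update p.1 i p.2))⁺) ^ 2))
    (fun i => (((hF.comp measurable_fst).sub
      (hF.comp (measurable_update_prod i))).sup_const 0 |>.pow_const 2).ennreal_ofReal) _ hV
  obtain ⟨h1, h2⟩ := eLpNorm_posPart_sub_integral_le _ hc hF hv
  rw [← map_vector_eq_pi hX hindep] at h1 h2
  have eint : ∫ x, F x ∂(P.map fun ω j => X j ω) = ∫ ω, Z F X ω ∂P :=
    integral_map hXm.aemeasurable hF.aestronglyMeasurable
  refine ⟨h1.comp_measurable hXm, fun q hq => ?_⟩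
  have h3 := h2 q (by omega)
  have hm : Measurable fun x => (F x - ∫ ω, Z F X ω ∂P)⁺ := (hF.sub_const _).sup_const 0
  rw [eint, eLpNorm_map_measure hm.aestronglyMeasurable hXm.aemeasurable] at h3
  exact h3

lemma Vplus_neg (P : Measure Ω) (F : (Fin n → E) → ℝ) (X X' : Fin n → Ω → E) :
    Vplus P (fun x => -F x) X X' = Vminus P F X X' := by
  unfold Vplus Vminus
  congr 1
  funext ω
  refine Finset.sum_congr rfl fun i _ => ?_
  rw [← posPart_neg]
  congr 3
  simp only [Z, Z']
  ring

end

end EfronStein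

theorem theorem1 {Ω E : Type*} [MeasurableSpace Ω] [MeasurableSpace E]
    (P : Measure Ω) [IsProbabilityMeasure P] (n : ℕ)
    (X X' : Fin n → Ω → E)
    (hX : ∀ i, Measurable (X i)) (hX' : ∀ i, Measurable (X' i))
    (hindep : iIndepFun (Sum.elim X X') P)
    (hcopy : ∀ i, IdentDistrib (X' i) (X i) P P)
    (F : (Fin n → E) → ℝ) (hF : Measurable F)
    (c : ℝ) (hc : 0 ≤ c)
    (hVplus : ∀ᵐ ω ∂P, EfronStein.Vplus P F X X' ω ≤ ENNReal.ofReal c) :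
    Integrable (EfronStein.Z F X) P ∧
    (∀ q : ℕ, 2 ≤ q →
      eLpNorm (fun ω => (EfronStein.Z F X ω - ∫ ω', EfronStein.Z F X ω' ∂P)⁺) q P
        ≤ ENNReal.ofReal (√(EfronStein.K * q * c))) ∧
    ((∀ᵐ ω ∂P, EfronStein.Vminus P F X X' ω ≤ ENNReal.ofReal c) →
      ∀ q : ℕ, 2 ≤ q →
        eLpNorm (EfronStein.Z F X) q P
          ≤ ENNReal.ofReal (|∫ ω, EfronStein.Z F X ω ∂P|
              + (2 : ℝ) ^ (1 / (q : ℝ)) * √(EfronStein.K * q * c))) := by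
  obtain ⟨hint, hpos⟩ := EfronStein.eLpNorm_posPart_Z_le hX hX' hindep hcopy hF hc hVplus
  refine ⟨hint, hpos, fun hVminus q hq => ?_⟩
  -- Negating `F` exchanges `V⁺` and `V⁻`, so the one-sided bound for `-F` controls the negative
  -- part of `Z - E Z`.
  rw [← EfronStein.Vplus_neg] at hVminus
  have hneg := (EfronStein.eLpNorm_posPart_Z_le hX hX' hindep hcopy
    (F := fun x => -F x) hF.neg hc hVminus).2 q hq
  simp only [EfronStein.Z_neg, integral_neg] at hneg
  set e := ∫ ω, EfronStein.Z F X ω ∂P with he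
  have hneg' : eLpNorm (fun ω => (EfronStein.Z F X ω - e)⁻) q P
      ≤ ENNReal.ofReal (√(EfronStein.K * q * c)) := by
    convert hneg using 3 with ω
    rw [← posPart_neg]
    congr 1
    ring
  have hZ : Measurable (EfronStein.Z F X) := hF.comp (measurable_pi_iff.2 hX)
  have hc' := EfronStein.eLpNorm_le_of_posPart_of_negPart (hZ.sub_const e) (by omega)
    (hpos q hq) hneg'
  have hsplit : EfronStein.Z F X = (fun _ => e) + fun ω => EfronStein.Z F X ω - e := by
    funext ω; simp
  have hconst : eLpNorm (fun _ : Ω => e) q P = ENNReal.ofReal |e| := by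
    rw [eLpNorm_const _ (by positivity) (IsProbabilityMeasure.ne_zero P), measure_univ]
    simp [Real.enorm_eq_ofReal_abs]
  rw [ENNReal.ofReal_add (abs_nonneg _) (by positivity), ← hconst]
  nth_rw 1 [hsplit]
  refine (eLpNorm_add_le aestronglyMeasurable_const (hZ.sub_const e).aestronglyMeasurable
    (by exact_mod_cast (by omega : 1 ≤ q))).trans ?_
  gcongr
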